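/- For rational numbers $a,b$ with $a\neq 0$, let $f(x)=x^8+ax^6+bx^4+ax^2+1\in\mathbb{Q}[x]$ and $g(x)=x^4+ax^3+bx^2+ax+1$, so that $f(x)=g(x^2)$. Write $\mathbb{Q}^2=\{k^2 : k\in\mathbb{Q}\}$. Suppose that $f$ is irreducible over $\mathbb{Q}$, that $(b+2)^2-4a^2\notin\mathbb{Q}^2$, and that $(a^2-4b+8)\big((b+2)^2-4a^2\big)\in\mathbb{Q}^2$. Then the Galois group of $g$ over $\mathbb{Q}$ is cyclic of order $4$, and the Galois group of $f$ over $\mathbb{Q}$, as a permutation group of the eight roots of $f$, is (up to conjugacy in $S_8$, that is, for a suitable numbering of the roots) 1. $8T2=\langle (1,2,3,8)(4,5,6,7),\ (1,5)(2,6)(3,7)(4,8)\rangle\cong C_4\times C_2$ if $b+2-2a\in\mathbb{Q}^2$ or $b+2+2a\in\mathbb{Q}^2$; 2. $8T10=\langle (1,2,3,8)(4,5,6,7),\ (1,5)(3,7)\rangle\cong C_2^2\rtimes C_4$ (of order $16$) otherwise. Here $8Tj$ denotes the $j$-th conjugacy class of transitive subgroups of $S_8$ in the numbering of Butler and McKay.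 -/

import Mathlib

open Polynomial

/-- The order-eight transitive group `8T2`, isomorphic to `C₄ × C₂` acting regularly.  It is generated
by `(1,2,3,8)(4,5,6,7)` and `(1,5)(2,6)(3,7)(4,8)`; the letters `1, …, 8` are written `0, …, 7`. -/
def T8_2 : Subgroup (Equiv.Perm (Fin 8)) :=
  Subgroup.closure
    {c[0, 1, 2, 7] * c[3, 4, 5, 6], c[0, 4] * c[1, 5] * c[2, 6] * c[3, 7]}

/-- The transitive group `8T10 = [2^2]4` of order sixteen, isomorphic to `C₂² ⋊ C₄`.  It is generated
by `(1,2,3,8)(4,5,6,7)` and `(1,5)(3,7)`; the letters `1, …, 8` are written `0, …, 7`. -/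
def T8_10 : Subgroup (Equiv.Perm (Fin 8)) :=
  Subgroup.closure
    {c[0, 1, 2, 7] * c[3, 4, 5, 6], c[0, 4] * c[2, 6]}

/-- `f` has `n` distinct complex roots, and for a suitable numbering of these roots the Galois
group of `f` over `ℚ`, as a group of permutations of the roots, is `H`.
As the numbering is arbitrary, this only depends on the conjugacy class of `H` in `Sₙ`. -/
def GaloisGroupIs (f : ℚ[X]) {n : ℕ} (H : Subgroup (Equiv.Perm (Fin n))) : Prop :=
  haveI : Fact (f.map (algebraMap ℚ ℂ)).Splits := Polynomial.Gal.splits_ℚ_ℂ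
  ∃ e : f.rootSet ℂ ≃ Fin n,
    (Polynomial.Gal.galActionHom f ℂ).range.map e.permCongrHom.toMonoidHom = H

/-! Put u = A + A⁻¹ and v = B + B⁻¹. Then (u - v)² = a² - 4b + 8 and (A - A⁻¹)²(B - B⁻¹)² = (u² -
4)(v² - 4) = (b + 2)² - 4a², so by hypothesis (u - v)(A - A⁻¹)(B - B⁻¹) is rational. An automorphism
fixing A therefore fixes B, and one sending A to B sends B to A⁻¹: the group of g is cyclic,
generated by the 4-cycle A → B → A⁻¹ → B⁻¹.

For f, write A = α², B = β² and lift that generator to ρ with ρ α = β; then ρ β = ε/α with ε = ±1.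
Every automorphism is ρ^k τ, where τ only changes signs of α and β. The element p = (α + ε/α)(β +
ε/β) satisfies p² = b + 2 - 2εa, is fixed by ρ, and is multiplied by the product of the two signs of
τ. If p is rational, the signs always agree, and ρ and negation generate `T8_2`. Otherwise some τ
has opposite signs, and the group is `T8_10`. The key results are `exists_rat_resolvent`,
`exists_pow_mul_of_map_mem_range` and `octicResolvent_sq`. -/

/-- `A, A⁻¹, B, B⁻¹` are the four roots of `X ^ 4 + a X ^ 3 + b X ^ 2 + a X + 1`, and they are
pairwise distinct. -/
structure IsReciprocalRoots {L : Type*} [Field L] [Algebra ℚ L] (a b : ℚ) (A B : L) : Prop where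
  left_ne_zero : A ≠ 0
  right_ne_zero : B ≠ 0
  sum_eq : A + A⁻¹ + (B + B⁻¹) = -algebraMap ℚ L a
  prod_eq : (A + A⁻¹) * (B + B⁻¹) = algebraMap ℚ L b - 2
  left_sub_inv_ne_zero : A - A⁻¹ ≠ 0
  right_sub_inv_ne_zero : B - B⁻¹ ≠ 0
  traces_sub_ne_zero : A + A⁻¹ - (B + B⁻¹) ≠ 0

/-! ### Rigidity of automorphisms on A and B -/

section AutomorphismsOnReciprocalRoots

variable {L : Type*} [Field L] [Algebra ℚ L]

theorem exists_eq_algebraMap_of_sq_eq_of_isSquare {z : L} {q : ℚ}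
    (hz : z ^ 2 = algebraMap ℚ L q) (hq : IsSquare q) :
    ∃ m : ℚ, z = algebraMap ℚ L m := by
  obtain ⟨m, rfl⟩ := hq
  rw [map_mul, ← sq] at hz
  rcases sq_eq_sq_iff_eq_or_eq_neg.mp hz with h | h
  · exact ⟨m, h⟩
  · exact ⟨-m, by rw [h, map_neg]⟩

theorem eq_of_add_inv_eq_of_sub_inv_eq {x y : L} (h₁ : x + x⁻¹ = y + y⁻¹)
    (h₂ : x - x⁻¹ = y - y⁻¹) : x = y := by
  have := algebraRat.charZero L
  have h : (2 : L) * x = 2 * y := by linear_combination h₁ + h₂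
  exact mul_left_cancel₀ two_ne_zero h

namespace IsReciprocalRoots

variable {a b : ℚ} {A B : L}

theorem exists_rat_resolvent (h : IsReciprocalRoots a b A B)
    (hsq : IsSquare ((a ^ 2 - 4 * b + 8) * ((b + 2) ^ 2 - 4 * a ^ 2))) :
    ∃ m : ℚ, (A + A⁻¹ - (B + B⁻¹)) * (A - A⁻¹) * (B - B⁻¹) = algebraMap ℚ L m := by
  refine exists_eq_algebraMap_of_sq_eq_of_isSquare ?_ hsq
  have hA : A * A⁻¹ = 1 := mul_inv_cancel₀ h.left_ne_zero
  have hB : B * B⁻¹ = 1 := mul_inv_cancel₀ h.right_ne_zero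
  have ha : algebraMap ℚ L a = -(A + A⁻¹ + (B + B⁻¹)) := by rw [h.sum_eq, neg_neg]
  have hb : algebraMap ℚ L b = (A + A⁻¹) * (B + B⁻¹) + 2 := by rw [h.prod_eq]; ring
  have hs : (A - A⁻¹) ^ 2 = (A + A⁻¹) ^ 2 - 4 := by linear_combination -4 * hA
  have ht : (B - B⁻¹) ^ 2 = (B + B⁻¹) ^ 2 - 4 := by linear_combination -4 * hB
  simp only [map_mul, map_sub, map_add, map_pow, map_ofNat, ha, hb]
  rw [mul_pow, mul_pow, hs, ht]
  ring

variable (σ : L ≃ₐ[ℚ] L)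

theorem map_sum_eq (h : IsReciprocalRoots a b A B) :
    σ A + (σ A)⁻¹ + (σ B + (σ B)⁻¹) = A + A⁻¹ + (B + B⁻¹) := by
  have := congrArg σ h.sum_eq
  simp only [map_add, map_neg, map_inv₀, AlgEquiv.commutes] at this
  rw [this, h.sum_eq]

theorem map_resolvent_eq (h : IsReciprocalRoots a b A B)
    (hsq : IsSquare ((a ^ 2 - 4 * b + 8) * ((b + 2) ^ 2 - 4 * a ^ 2))) :
    (σ A + (σ A)⁻¹ - (σ B + (σ B)⁻¹)) * (σ A - (σ A)⁻¹) * (σ B - (σ B)⁻¹) =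
      (A + A⁻¹ - (B + B⁻¹)) * (A - A⁻¹) * (B - B⁻¹) := by
  obtain ⟨m, hm⟩ := h.exists_rat_resolvent hsq
  have := congrArg σ hm
  simp only [map_add, map_sub, map_mul, map_inv₀, AlgEquiv.commutes] at this
  rw [this, hm]

/-- The invariant sum forces σ to fix B + B⁻¹; cancelling the nonzero fixed factors of the rational
product then fixes B - B⁻¹. -/
theorem map_right_of_map_left_eq_left (h : IsReciprocalRoots a b A B)
    (hsq : IsSquare ((a ^ 2 - 4 * b + 8) * ((b + 2) ^ 2 - 4 * a ^ 2)))
    (hσ : σ A = A) : σ B = B := by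
  have h₁ := h.map_sum_eq σ
  have h₂ := h.map_resolvent_eq σ hsq
  rw [hσ] at h₁ h₂
  have h₃ := add_left_cancel h₁
  rw [h₃] at h₂
  exact eq_of_add_inv_eq_of_sub_inv_eq h₃
    (mul_left_cancel₀ (mul_ne_zero h.traces_sub_ne_zero h.left_sub_inv_ne_zero) h₂)

/-- Here the two traces are swapped, so their difference changes sign, and the rational product
forces B - B⁻¹ to go to -(A - A⁻¹). -/
theorem map_right_of_map_left_eq_right (h : IsReciprocalRoots a b A B)
    (hsq : IsSquare ((a ^ 2 - 4 * b + 8) * ((b + 2) ^ 2 - 4 * a ^ 2)))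
    (hσ : σ A = B) : σ B = A⁻¹ := by
  have h₁ := h.map_sum_eq σ
  have h₂ := h.map_resolvent_eq σ hsq
  rw [hσ] at h₁ h₂
  have h₃ : σ B + (σ B)⁻¹ = A + A⁻¹ := by linear_combination h₁
  rw [h₃] at h₂
  refine eq_of_add_inv_eq_of_sub_inv_eq (by rw [h₃, inv_inv, add_comm]) ?_
  rw [inv_inv]
  refine mul_left_cancel₀ (mul_ne_zero h.traces_sub_ne_zero h.right_sub_inv_ne_zero) ?_
  linear_combination -h₂

end IsReciprocalRoots

end AutomorphismsOnReciprocalRoots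

/-! ### The quartic g and its cyclic group -/

section ReciprocalQuartic

variable {a b : ℚ}

/-- If this vanished, the quartic would be the square of X² + (a/2)X + 1. -/
theorem disc_ne_zero_of_irreducible
    (hg : Irreducible (X ^ 4 + C a * X ^ 3 + C b * X ^ 2 + C a * X + 1 : ℚ[X])) :
    a ^ 2 - 4 * b + 8 ≠ 0 := by
  intro hd
  have hb : b = 2 * 1 + a / 2 * (a / 2) := by linear_combination -(1 / 4 : ℚ) * hd
  refine hg.not_isSquare ⟨X ^ 2 + C (a / 2) * X + 1, ?_⟩
  have ha : (C a : ℚ[X]) = 2 * C (a / 2) := by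
    rw [← map_ofNat C 2, ← C_mul]
    congr 1
    ring
  rw [ha, hb, C_add, C_mul, C_mul, map_ofNat, C_1]
  ring

variable {L : Type*} [Field L] [Algebra ℚ L]

/-- The quartic is (X² - uX + 1)(X² - vX + 1) with u + v = -a; the condition on B makes it a root of
the second factor. The three nonvanishing conditions come from the two discriminant factors. -/
theorem isReciprocalRoots_of_root {A B : L}
    (hg : Irreducible (X ^ 4 + C a * X ^ 3 + C b * X ^ 2 + C a * X + 1 : ℚ[X]))
    (hD : (b + 2) ^ 2 - 4 * a ^ 2 ≠ 0)
    (hA : A ^ 4 + algebraMap ℚ L a * A ^ 3 + algebraMap ℚ L b * A ^ 2 + algebraMap ℚ L a * A + 1 = 0)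
    (hB : B ^ 2 + (algebraMap ℚ L a + A + A⁻¹) * B + 1 = 0) :
    IsReciprocalRoots a b A B := by
  have hA₀ : A ≠ 0 := by
    rintro rfl
    simp at hA
  have hB₀ : B ≠ 0 := by
    rintro rfl
    simp at hB
  have hA₁ : A * A⁻¹ = 1 := mul_inv_cancel₀ hA₀
  have hB₁ : B * B⁻¹ = 1 := mul_inv_cancel₀ hB₀
  have hsum : A + A⁻¹ + (B + B⁻¹) = -algebraMap ℚ L a := by
    apply mul_left_cancel₀ hB₀
    linear_combination hB + hB₁
  have hprod : (A + A⁻¹) * (B + B⁻¹) = algebraMap ℚ L b - 2 := by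
    have hv : B + B⁻¹ = -algebraMap ℚ L a - (A + A⁻¹) := by linear_combination hsum
    rw [hv]
    apply mul_left_cancel₀ (pow_ne_zero 2 hA₀)
    linear_combination -hA - (algebraMap ℚ L a * A + A * A⁻¹ + 1 + 2 * A ^ 2) * hA₁
  have ha : algebraMap ℚ L a = -(A + A⁻¹ + (B + B⁻¹)) := by rw [hsum, neg_neg]
  have hb : algebraMap ℚ L b = (A + A⁻¹) * (B + B⁻¹) + 2 := by rw [hprod]; ring
  have hD' : (A - A⁻¹) ^ 2 * (B - B⁻¹) ^ 2 = algebraMap ℚ L ((b + 2) ^ 2 - 4 * a ^ 2) := by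
    have hs : (A - A⁻¹) ^ 2 = (A + A⁻¹) ^ 2 - 4 := by linear_combination -4 * hA₁
    have ht : (B - B⁻¹) ^ 2 = (B + B⁻¹) ^ 2 - 4 := by linear_combination -4 * hB₁
    simp only [map_mul, map_sub, map_add, map_pow, map_ofNat, ha, hb, hs, ht]
    ring
  have hd' : (A + A⁻¹ - (B + B⁻¹)) ^ 2 = algebraMap ℚ L (a ^ 2 - 4 * b + 8) := by
    simp only [map_mul, map_sub, map_add, map_pow, map_ofNat, ha, hb]
    ring
  have hst : (A - A⁻¹) ^ 2 * (B - B⁻¹) ^ 2 ≠ 0 := by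
    rw [hD']
    exact (_root_.map_ne_zero _).mpr hD
  refine ⟨hA₀, hB₀, hsum, hprod, ?_, ?_, ?_⟩
  · exact ne_zero_pow two_ne_zero (left_ne_zero_of_mul hst)
  · exact ne_zero_pow two_ne_zero (right_ne_zero_of_mul hst)
  · refine ne_zero_pow two_ne_zero (n := 2) ?_
    rw [hd']
    exact (_root_.map_ne_zero _).mpr (disc_ne_zero_of_irreducible hg)

theorem natDegree_reciprocalQuartic :
    (X ^ 4 + C a * X ^ 3 + C b * X ^ 2 + C a * X + 1 : ℚ[X]).natDegree = 4 := by
  compute_degree!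

theorem exists_isReciprocalRoots {g : ℚ[X]}
    (hg : g = X ^ 4 + C a * X ^ 3 + C b * X ^ 2 + C a * X + 1) (hirr : Irreducible g)
    (hD : (b + 2) ^ 2 - 4 * a ^ 2 ≠ 0) (hs : (g.map (algebraMap ℚ L)).Splits) :
    ∃ A B : L, IsReciprocalRoots a b A B := by
  subst hg
  have hdeg : ((X ^ 4 + C a * X ^ 3 + C b * X ^ 2 + C a * X + 1 : ℚ[X]).map
      (algebraMap ℚ L)).degree ≠ 0 := by
    rw [degree_map]
    exact degree_ne_of_natDegree_ne (by rw [natDegree_reciprocalQuartic]; decide)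
  obtain ⟨A, hA⟩ := hs.exists_eval_eq_zero hdeg
  simp only [Polynomial.map_add, Polynomial.map_mul, Polynomial.map_pow, map_X, map_C,
    Polynomial.map_one, eval_add, eval_mul, eval_pow, eval_X, eval_C, eval_one] at hA
  have hA₀ : A ≠ 0 := by
    rintro rfl
    simp at hA
  have hA₁ : A * A⁻¹ = 1 := mul_inv_cancel₀ hA₀
  have hdvd : (X ^ 2 + C (algebraMap ℚ L a + A + A⁻¹) * X + 1 : L[X]) ∣
      (X ^ 4 + C a * X ^ 3 + C b * X ^ 2 + C a * X + 1 : ℚ[X]).map (algebraMap ℚ L) := by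
    refine ⟨X ^ 2 - C (A + A⁻¹) * X + 1, ?_⟩
    have hb : algebraMap ℚ L b = 2 - (A + A⁻¹) * (algebraMap ℚ L a + A + A⁻¹) := by
      apply mul_left_cancel₀ (pow_ne_zero 2 hA₀)
      linear_combination hA + (algebraMap ℚ L a * A + A * A⁻¹ + 1 + 2 * A ^ 2) * hA₁
    simp only [Polynomial.map_add, Polynomial.map_mul, Polynomial.map_pow, map_X, map_C,
      Polynomial.map_one, hb, C_sub, C_mul, C_add, map_ofNat]
    ring
  have hdeg₂ : (X ^ 2 + C (algebraMap ℚ L a + A + A⁻¹) * X + 1 : L[X]).degree ≠ 0 := by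
    refine degree_ne_of_natDegree_ne (n := 0) ?_
    have : (X ^ 2 + C (algebraMap ℚ L a + A + A⁻¹) * X + 1 : L[X]).natDegree = 2 := by
      compute_degree!
    rw [this]
    decide
  obtain ⟨B, hB⟩ := (hs.of_dvd (map_ne_zero hirr.ne_zero) hdvd).exists_eval_eq_zero hdeg₂
  simp only [eval_add, eval_mul, eval_pow, eval_X, eval_C, eval_one] at hB
  exact ⟨A, B, isReciprocalRoots_of_root hirr hD hA hB⟩

theorem IsReciprocalRoots.eval_eq {A B : L} (h : IsReciprocalRoots a b A B) (z : L) :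
    z ^ 4 + algebraMap ℚ L a * z ^ 3 + algebraMap ℚ L b * z ^ 2 + algebraMap ℚ L a * z + 1 =
      (z - A) * (z - A⁻¹) * ((z - B) * (z - B⁻¹)) := by
  have hA : A * A⁻¹ = 1 := mul_inv_cancel₀ h.left_ne_zero
  have hB : B * B⁻¹ = 1 := mul_inv_cancel₀ h.right_ne_zero
  have ha : algebraMap ℚ L a = -(A + A⁻¹ + (B + B⁻¹)) := by rw [h.sum_eq, neg_neg]
  have hb : algebraMap ℚ L b = (A + A⁻¹) * (B + B⁻¹) + 2 := by rw [h.prod_eq]; ring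
  have h₁ : (z - A) * (z - A⁻¹) = z ^ 2 - (A + A⁻¹) * z + 1 := by linear_combination hA
  have h₂ : (z - B) * (z - B⁻¹) = z ^ 2 - (B + B⁻¹) * z + 1 := by linear_combination hB
  rw [h₁, h₂, ha, hb]
  ring

theorem IsReciprocalRoots.root_cases {A B : L} (h : IsReciprocalRoots a b A B) {z : L}
    (hz : z ^ 4 + algebraMap ℚ L a * z ^ 3 + algebraMap ℚ L b * z ^ 2 + algebraMap ℚ L a * z + 1
      = 0) : (z = A ∨ z = A⁻¹) ∨ (z = B ∨ z = B⁻¹) := by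
  rw [h.eval_eq] at hz
  simpa only [mul_eq_zero, sub_eq_zero] using hz

theorem exists_algEquiv_map_eq_of_irreducible [Normal ℚ L] {f : ℚ[X]} (hirr : Irreducible f)
    {x y : L} (hx : aeval x f = 0) (hy : aeval y f = 0) : ∃ σ : L ≃ₐ[ℚ] L, σ x = y := by
  have h := (minpoly.eq_of_irreducible hirr hy).symm.trans (minpoly.eq_of_irreducible hirr hx)
  exact (Normal.minpoly_eq_iff_mem_orbit L).mp h

theorem algEquiv_ext_of_isSplittingField {f : ℚ[X]} [IsSplittingField ℚ L f] {σ τ : L ≃ₐ[ℚ] L}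
    (h : ∀ x : L, aeval x f = 0 → σ x = τ x) : σ = τ := by
  refine AlgEquiv.coe_toAlgHom_injective
    (AlgHom.ext_of_adjoin_eq_top (IsSplittingField.adjoin_rootSet L f) fun x hx ↦ ?_)
  exact h x (mem_rootSet.mp hx).2

/-- An automorphism is determined by the image of A, and the powers of the automorphism A ↦ B
already reach all four roots. -/
theorem isCyclic_algEquiv_of_isSplittingField {g : ℚ[X]} [IsSplittingField ℚ L g]
    (hg : g = X ^ 4 + C a * X ^ 3 + C b * X ^ 2 + C a * X + 1) (hirr : Irreducible g)
    (hD : (b + 2) ^ 2 - 4 * a ^ 2 ≠ 0)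
    (hsq : IsSquare ((a ^ 2 - 4 * b + 8) * ((b + 2) ^ 2 - 4 * a ^ 2))) :
    IsCyclic (L ≃ₐ[ℚ] L) ∧ Nat.card (L ≃ₐ[ℚ] L) = 4 := by
  have : Normal ℚ L := Normal.of_isSplittingField g
  obtain ⟨A, B, h⟩ := exists_isReciprocalRoots hg hirr hD (IsSplittingField.splits L g)
  have haeval (z : L) : aeval z g = z ^ 4 + algebraMap ℚ _ a * z ^ 3 +
      algebraMap ℚ _ b * z ^ 2 + algebraMap ℚ _ a * z + 1 := by
    rw [hg]
    simp only [map_add, map_mul, map_pow, aeval_X, aeval_C, map_one]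
  have hfix (σ : L ≃ₐ[ℚ] L) (hσ : σ A = A) : σ = 1 := by
    have hσB := h.map_right_of_map_left_eq_left σ hsq hσ
    refine algEquiv_ext_of_isSplittingField (f := g) fun z hz₀ ↦ ?_
    rw [AlgEquiv.one_apply]
    rw [haeval] at hz₀
    rcases h.root_cases hz₀ with (rfl | rfl) | (rfl | rfl)
    · exact hσ
    · rw [map_inv₀, hσ]
    · exact hσB
    · rw [map_inv₀, hσB]
  obtain ⟨ρ, hρA⟩ : ∃ ρ : L ≃ₐ[ℚ] L, ρ A = B :=
    exists_algEquiv_map_eq_of_irreducible hirr (by rw [haeval, h.eval_eq]; simp) (by rw [haeval, h.eval_eq]; simp)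
  have hρB : ρ B = A⁻¹ := h.map_right_of_map_left_eq_right ρ hsq hρA
  have hρ₂ : (ρ ^ 2) A = A⁻¹ := by rw [sq, AlgEquiv.mul_apply, hρA, hρB]
  have hρ₃ : (ρ ^ 3) A = B⁻¹ := by rw [pow_succ', AlgEquiv.mul_apply, hρ₂, map_inv₀, hρA]
  have hρ₄ : ρ ^ 4 = 1 :=
    hfix _ (by rw [pow_succ', AlgEquiv.mul_apply, hρ₃, map_inv₀, hρB, inv_inv])
  have hord : orderOf ρ = 4 := by
    refine orderOf_eq_prime_pow (p := 2) (n := 1) ?_ hρ₄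
    intro hρ
    rw [pow_one] at hρ
    rw [hρ, AlgEquiv.one_apply] at hρ₂
    exact h.left_sub_inv_ne_zero (sub_eq_zero.mpr hρ₂)
  have hgen : ∀ σ : L ≃ₐ[ℚ] L, σ ∈ Subgroup.zpowers ρ := by
    intro σ
    have key (k : ℕ) (hk : σ A = (ρ ^ k) A) : σ ∈ Subgroup.zpowers ρ := by
      have : (ρ ^ k)⁻¹ * σ = 1 := hfix _ (by
        rw [AlgEquiv.mul_apply, hk, ← AlgEquiv.mul_apply, inv_mul_cancel, AlgEquiv.one_apply])
      rw [inv_mul_eq_one] at this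
      exact this ▸ Subgroup.npow_mem_zpowers ρ k
    have hz : aeval (σ A) g = 0 := by
      rw [aeval_algHom_apply σ A g, haeval, h.eval_eq]
      simp
    rw [haeval] at hz
    rcases h.root_cases hz with (hz | hz) | (hz | hz)
    · exact key 0 (by rw [hz, pow_zero, AlgEquiv.one_apply])
    · exact key 2 (by rw [hz, hρ₂])
    · exact key 1 (by rw [hz, pow_one, hρA])
    · exact key 3 (by rw [hz, hρ₃])
  exact ⟨⟨ρ, hgen⟩, by rw [← orderOf_eq_card_of_forall_mem_zpowers hgen, hord]⟩

end ReciprocalQuartic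

/-! ### From numberings of roots to permutation groups -/

/-- A numbering of the roots in the splitting field that turns the Galois action into a given
homomorphism to `Perm ι` identifies the Galois group, acting on the roots in a larger field, with
the range of this homomorphism. -/
theorem exists_equiv_map_range_galActionHom_eq {F E ι : Type*} [Field F] [Field E] [Algebra F E]
    (p : F[X]) [Fact (p.map (algebraMap F E)).Splits] (x : ι → p.SplittingField)
    (hinj : Function.Injective x) (hrange : Set.range x = p.rootSet p.SplittingField)
    (φ : p.Gal →* Equiv.Perm ι) (hφ : ∀ σ i, x (φ σ i) = σ (x i)) :
    ∃ e : p.rootSet E ≃ ι,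
      (Gal.galActionHom p E).range.map e.permCongrHom.toMonoidHom = φ.range := by
  let e₀ : ι ≃ p.rootSet p.SplittingField :=
    (Equiv.ofInjective x hinj).trans (Equiv.setCongr hrange)
  let e : p.rootSet E ≃ ι := (Gal.rootsEquivRoots p E).symm.trans e₀.symm
  refine ⟨e, ?_⟩
  have : φ = e.permCongrHom.toMonoidHom.comp (Gal.galActionHom p E) := by
    ext σ i
    refine e₀.injective (Subtype.ext ((hφ σ i).trans ?_))
    -- The action on the roots in `E` is by definition transported from the splitting field along
    -- `rootsEquivRoots`.
    have h₁ : e.permCongrHom.toMonoidHom.comp (Gal.galActionHom p E) σ i =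
      e₀.symm ((Gal.rootsEquivRoots p E).symm (Gal.rootsEquivRoots p E
        (σ • (Gal.rootsEquivRoots p E).symm (Gal.rootsEquivRoots p E (e₀ i))))) := rfl
    rw [h₁, Equiv.apply_symm_apply, Equiv.symm_apply_apply, Equiv.symm_apply_apply]
    rfl
  rw [this, MonoidHom.range_comp]

/-- A group of automorphisms preserving the range of an injective family permutes its indices. -/
theorem exists_permHom_of_mapsTo {L ι : Type*} [Field L] [Algebra ℚ L] (x : ι → L)
    (hinj : Function.Injective x) (h : ∀ (σ : L ≃ₐ[ℚ] L) i, σ (x i) ∈ Set.range x) :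
    ∃ φ : (L ≃ₐ[ℚ] L) →* Equiv.Perm ι, ∀ σ i, x (φ σ i) = σ (x i) := by
  choose r hr using h
  let _ : MulAction (L ≃ₐ[ℚ] L) ι :=
    { smul := r
      one_smul := fun i ↦ hinj (hr 1 i)
      mul_smul := fun σ τ i ↦ hinj <| (hr (σ * τ) i).trans <| by
        change σ (τ (x i)) = x (r σ (r τ i))
        rw [hr, hr] }
  exact ⟨MulAction.toPermHom (L ≃ₐ[ℚ] L) ι, hr⟩

/-! ### The eight roots of f -/

section ReciprocalOctic

/-- The eight elements `± α, ± β, ± ε / α, ± ε / β`, in the numbering that suits `T8_2` and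
`T8_10`. -/
def octicRoots {L : Type*} [Field L] (ε α β : L) : Fin 8 → L :=
  ![α, β, ε / α, -(ε / β), -α, -β, -(ε / α), ε / β]

variable {a b : ℚ} {f : ℚ[X]}

theorem exists_sq_isReciprocalRoots {L : Type*} [Field L] [Algebra ℚ L]
    (hf : f = X ^ 8 + C a * X ^ 6 + C b * X ^ 4 + C a * X ^ 2 + 1)
    (hg : Irreducible (X ^ 4 + C a * X ^ 3 + C b * X ^ 2 + C a * X + 1 : ℚ[X]))
    (hirr : Irreducible f)
    (hD : (b + 2) ^ 2 - 4 * a ^ 2 ≠ 0) (hs : (f.map (algebraMap ℚ L)).Splits) :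
    ∃ α β : L, IsReciprocalRoots a b (α ^ 2) (β ^ 2) := by
  have hdeg : (f.map (algebraMap ℚ L)).degree ≠ 0 := by
    rw [degree_map]
    refine degree_ne_of_natDegree_ne (n := 0) ?_
    have : f.natDegree = 8 := by rw [hf]; compute_degree!
    rw [this]
    decide
  obtain ⟨α, hα⟩ := hs.exists_eval_eq_zero hdeg
  have hmap : f.map (algebraMap ℚ L) = X ^ 8 + C (algebraMap ℚ L a) * X ^ 6 +
      C (algebraMap ℚ L b) * X ^ 4 + C (algebraMap ℚ L a) * X ^ 2 + 1 := by
    rw [hf]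
    simp only [Polynomial.map_add, Polynomial.map_mul, Polynomial.map_pow, map_X, map_C,
      Polynomial.map_one]
  rw [hmap] at hα
  simp only [eval_add, eval_mul, eval_pow, eval_X, eval_C, eval_one] at hα
  have hα₀ : α ≠ 0 := by
    rintro rfl
    simp at hα
  have hA : (α ^ 2) ^ 4 + algebraMap ℚ L a * (α ^ 2) ^ 3 + algebraMap ℚ L b * (α ^ 2) ^ 2 +
      algebraMap ℚ L a * α ^ 2 + 1 = 0 := by linear_combination hα
  have hA₁ : α ^ 2 * (α ^ 2)⁻¹ = 1 := mul_inv_cancel₀ (pow_ne_zero 2 hα₀)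
  -- This is the factor X² - vX + 1 of g evaluated at X²; its root β is a square root of B already
  -- lying in `L`.
  have hdvd : (X ^ 4 + C (algebraMap ℚ L a + α ^ 2 + (α ^ 2)⁻¹) * X ^ 2 + 1 : L[X]) ∣
      f.map (algebraMap ℚ L) := by
    refine ⟨X ^ 4 - C (α ^ 2 + (α ^ 2)⁻¹) * X ^ 2 + 1, ?_⟩
    have hb : algebraMap ℚ L b =
        2 - (α ^ 2 + (α ^ 2)⁻¹) * (algebraMap ℚ L a + α ^ 2 + (α ^ 2)⁻¹) := by
      apply mul_left_cancel₀ (pow_ne_zero 2 (pow_ne_zero 2 hα₀))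
      linear_combination hA + (algebraMap ℚ L a * α ^ 2 + α ^ 2 * (α ^ 2)⁻¹ + 1 +
        2 * (α ^ 2) ^ 2) * hA₁
    rw [hmap]
    simp only [hb, C_sub, C_mul, C_add, map_ofNat]
    ring
  have hdeg₂ : (X ^ 4 + C (algebraMap ℚ L a + α ^ 2 + (α ^ 2)⁻¹) * X ^ 2 + 1 : L[X]).degree ≠ 0 := by
    refine degree_ne_of_natDegree_ne (n := 0) ?_
    have : (X ^ 4 + C (algebraMap ℚ L a + α ^ 2 + (α ^ 2)⁻¹) * X ^ 2 + 1 : L[X]).natDegree = 4 := by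
      compute_degree!
    rw [this]
    decide
  obtain ⟨β, hβ⟩ := (hs.of_dvd (map_ne_zero hirr.ne_zero) hdvd).exists_eval_eq_zero hdeg₂
  simp only [eval_add, eval_mul, eval_pow, eval_X, eval_C, eval_one] at hβ
  exact ⟨α, β, isReciprocalRoots_of_root hg hD hA (by linear_combination hβ)⟩

theorem aeval_reciprocalOctic {L : Type*} [Field L] [Algebra ℚ L]
    (hf : f = X ^ 8 + C a * X ^ 6 + C b * X ^ 4 + C a * X ^ 2 + 1)
    {α β : L} (h : IsReciprocalRoots a b (α ^ 2) (β ^ 2)) (z : L) :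
    aeval z f = (z ^ 2 - α ^ 2) * (z ^ 2 - (α ^ 2)⁻¹) * ((z ^ 2 - β ^ 2) * (z ^ 2 - (β ^ 2)⁻¹)) := by
  rw [← h.eval_eq, hf]
  simp only [map_add, map_mul, map_pow, aeval_X, aeval_C, map_one]
  ring

theorem range_octicRoots {L : Type*} [Field L] [Algebra ℚ L] {ε : ℚ} (hε : ε ^ 2 = 1)
    (hf : f = X ^ 8 + C a * X ^ 6 + C b * X ^ 4 + C a * X ^ 2 + 1) (hf₀ : f ≠ 0)
    {α β : L} (h : IsReciprocalRoots a b (α ^ 2) (β ^ 2)) :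
    Set.range (octicRoots (algebraMap ℚ L ε) α β) = f.rootSet L := by
  have hε' : (algebraMap ℚ L ε) ^ 2 = 1 := by rw [← map_pow, hε, map_one]
  have hinv (y : L) : (y ^ 2)⁻¹ = (algebraMap ℚ L ε / y) ^ 2 := by
    rw [div_pow, hε', one_div]
  ext z
  rw [mem_rootSet_of_ne hf₀, aeval_reciprocalOctic hf h, hinv, hinv]
  simp only [mul_eq_zero, sub_eq_zero, sq_eq_sq_iff_eq_or_eq_neg, Set.mem_range, octicRoots,
    Fin.exists_fin_succ, Matrix.cons_val_zero, Matrix.cons_val_succ, IsEmpty.exists_iff, or_false,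
    @eq_comm _ _ z]
  tauto

/-- By counting: the family maps eight indices onto the eight roots of the separable polynomial f.
-/
theorem injective_octicRoots {L : Type*} [Field L] [Algebra ℚ L] {ε : ℚ} (hε : ε ^ 2 = 1)
    (hf : f = X ^ 8 + C a * X ^ 6 + C b * X ^ 4 + C a * X ^ 2 + 1) (hirr : Irreducible f)
    [IsSplittingField ℚ L f] {α β : L} (h : IsReciprocalRoots a b (α ^ 2) (β ^ 2)) :
    Function.Injective (octicRoots (algebraMap ℚ _ ε) α β) := by
  have hcard : Fintype.card (f.rootSet L) = 8 := by
    rw [card_rootSet_eq_natDegree hirr.separable (IsSplittingField.splits L f), hf]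
    compute_degree!
  have hrange := range_octicRoots hε hf hirr.ne_zero h
  rw [← Set.injective_codRestrict (s := f.rootSet L)
    (fun i ↦ hrange ▸ Set.mem_range_self i)]
  refine ((Fintype.bijective_iff_surjective_and_card _).mpr ⟨?_, ?_⟩).1
  · rintro ⟨z, hz⟩
    rw [← hrange] at hz
    obtain ⟨i, rfl⟩ := hz
    exact ⟨i, rfl⟩
  · rw [hcard, Fintype.card_fin]

end ReciprocalOctic

/-! ### Explicit permutations of the eight indices -/

section OcticGenerators

theorem coe_rotation :
    ⇑(c[0, 1, 2, 7] * c[3, 4, 5, 6] : Equiv.Perm (Fin 8)) = ![1, 2, 7, 4, 5, 6, 3, 0] := by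
  decide

theorem coe_negation :
    ⇑(c[0, 4] * c[1, 5] * c[2, 6] * c[3, 7] : Equiv.Perm (Fin 8)) = ![4, 5, 6, 7, 0, 1, 2, 3] := by
  decide

theorem coe_evenNegation :
    ⇑(c[0, 4] * c[2, 6] : Equiv.Perm (Fin 8)) = ![4, 1, 6, 3, 0, 5, 2, 7] := by
  decide

theorem coe_oddNegation :
    ⇑(c[1, 5] * c[3, 7] : Equiv.Perm (Fin 8)) = ![0, 5, 2, 7, 4, 1, 6, 3] := by
  decide

theorem oddNegation_eq_conj :
    (c[1, 5] * c[3, 7] : Equiv.Perm (Fin 8)) = c[0, 1, 2, 7] * c[3, 4, 5, 6] * (c[0, 4] * c[2, 6]) *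
      (c[0, 1, 2, 7] * c[3, 4, 5, 6])⁻¹ := by
  decide

theorem negation_eq_mul :
    (c[0, 4] * c[1, 5] * c[2, 6] * c[3, 7] : Equiv.Perm (Fin 8)) =
      c[0, 4] * c[2, 6] * (c[1, 5] * c[3, 7]) := by
  decide

end OcticGenerators

/-! ### Galois action on the numbered roots -/

section ReciprocalOcticAction

variable {L : Type*} [Field L] [Algebra ℚ L] {ε : ℚ} {α β : L}
  {φ : (L ≃ₐ[ℚ] L) →* Equiv.Perm (Fin 8)}

/-- ρ runs through α → β → ε/α → ε/β → α and through the negatives of these. Indices `i` and `i + 4`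
carry opposite roots; the minus sign at index 3 puts ε/β at index 7, which closes the first cycle as
0, 1, 2, 7. -/
theorem permHom_eq_rotation (hε : ε ^ 2 = 1)
    (hinj : Function.Injective (octicRoots (algebraMap ℚ L ε) α β))
    (hφ : ∀ σ i, octicRoots (algebraMap ℚ L ε) α β (φ σ i) =
      σ (octicRoots (algebraMap ℚ L ε) α β i))
    {ρ : L ≃ₐ[ℚ] L} (hα : ρ α = β) (hβ : ρ β = algebraMap ℚ L ε / α) :
    φ ρ = c[0, 1, 2, 7] * c[3, 4, 5, 6] := by
  have hε₀ : algebraMap ℚ L ε ≠ 0 := by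
    refine (_root_.map_ne_zero _).mpr ?_
    rintro rfl
    norm_num at hε
  refine Equiv.ext fun i ↦ hinj ?_
  rw [hφ, coe_rotation]
  fin_cases i <;> simp [octicRoots, hα, hβ, -eq_ratCast, div_div_cancel₀ hε₀]

theorem permHom_eq_of_map_eq_or_neg
    (hinj : Function.Injective (octicRoots (algebraMap ℚ L ε) α β))
    (hφ : ∀ σ i, octicRoots (algebraMap ℚ L ε) α β (φ σ i) =
      σ (octicRoots (algebraMap ℚ L ε) α β i)) (τ : L ≃ₐ[ℚ] L) :
    (τ α = α → τ β = β → φ τ = 1) ∧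
    (τ α = -α → τ β = -β → φ τ = c[0, 4] * c[1, 5] * c[2, 6] * c[3, 7]) ∧
    (τ α = -α → τ β = β → φ τ = c[0, 4] * c[2, 6]) ∧
    (τ α = α → τ β = -β → φ τ = c[1, 5] * c[3, 7]) := by
  refine ⟨fun hα hβ ↦ ?_, fun hα hβ ↦ ?_, fun hα hβ ↦ ?_, fun hα hβ ↦ ?_⟩ <;>
    refine Equiv.ext fun i ↦ hinj ?_
  · rw [hφ, Equiv.Perm.one_apply]
    fin_cases i <;> simp [octicRoots, hα, hβ]
  · rw [hφ, coe_negation]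
    fin_cases i <;> simp [octicRoots, hα, hβ, div_neg]
  · rw [hφ, coe_evenNegation]
    fin_cases i <;> simp [octicRoots, hα, hβ, div_neg]
  · rw [hφ, coe_oddNegation]
    fin_cases i <;> simp [octicRoots, hα, hβ, div_neg]

/-- Every automorphism differs by a power of `ρ` from one that fixes `α` and `β` up to sign. -/
theorem exists_pow_mul_of_map_mem_range (hε : ε ^ 2 = 1)
    (hfix : ∀ σ : L ≃ₐ[ℚ] L, σ (α ^ 2) = α ^ 2 → σ (β ^ 2) = β ^ 2)
    {ρ : L ≃ₐ[ℚ] L} (hα : ρ α = β) (hβ : ρ β = algebraMap ℚ L ε / α)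
    {σ : L ≃ₐ[ℚ] L} (hσ : σ α ∈ Set.range (octicRoots (algebraMap ℚ L ε) α β)) :
    ∃ (k : ℕ) (τ : L ≃ₐ[ℚ] L), σ = ρ ^ k * τ ∧ (τ α = α ∨ τ α = -α) ∧ (τ β = β ∨ τ β = -β) := by
  have key (k : ℕ) (hk : σ α = (ρ ^ k) α ∨ σ α = -(ρ ^ k) α) :
      ∃ (k : ℕ) (τ : L ≃ₐ[ℚ] L), σ = ρ ^ k * τ ∧ (τ α = α ∨ τ α = -α) ∧ (τ β = β ∨ τ β = -β) := by
    have hinv : (ρ ^ k)⁻¹ ((ρ ^ k) α) = α := by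
      rw [← AlgEquiv.mul_apply, inv_mul_cancel, AlgEquiv.one_apply]
    have hτ : ((ρ ^ k)⁻¹ * σ) α = α ∨ ((ρ ^ k)⁻¹ * σ) α = -α := by
      rcases hk with hk | hk
      · exact Or.inl (by rw [AlgEquiv.mul_apply, hk, hinv])
      · exact Or.inr (by rw [AlgEquiv.mul_apply, hk, map_neg, hinv])
    refine ⟨k, (ρ ^ k)⁻¹ * σ, (mul_inv_cancel_left _ _).symm, hτ, ?_⟩
    -- Equality up to sign is equality of squares, so the rigidity on A = α² and B = β² applies.
    rw [← sq_eq_sq_iff_eq_or_eq_neg, ← map_pow] at hτ ⊢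
    exact hfix _ hτ
  have hε₀ : algebraMap ℚ L ε ≠ 0 := by
    refine (_root_.map_ne_zero _).mpr ?_
    rintro rfl
    norm_num at hε
  have h₂ : (ρ ^ 2) α = algebraMap ℚ L ε / α := by rw [sq, AlgEquiv.mul_apply, hα, hβ]
  have h₃ : (ρ ^ 3) α = algebraMap ℚ L ε / β := by
    rw [pow_succ', AlgEquiv.mul_apply, h₂, map_div₀, AlgEquiv.commutes, hα]
  obtain ⟨i, hi⟩ := hσ
  fin_cases i <;> simp only [octicRoots] at hi
  · exact key 0 (Or.inl hi.symm)
  · exact key 1 (Or.inl (by rw [pow_one, hα]; exact hi.symm))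
  · exact key 2 (Or.inl (by rw [h₂]; exact hi.symm))
  · exact key 3 (Or.inr (by rw [h₃]; exact hi.symm))
  · exact key 0 (Or.inr hi.symm)
  · exact key 1 (Or.inr (by rw [pow_one, hα]; exact hi.symm))
  · exact key 2 (Or.inr (by rw [h₂]; exact hi.symm))
  · exact key 3 (Or.inl (by rw [h₃]; exact hi.symm))

/-- The square root `(α + ε / α) (β + ε / β)` of `b + 2 - 2 ε a`. -/
def octicResolvent (ε α β : L) : L := (α + ε / α) * (β + ε / β)

theorem octicResolvent_sq {a b : ℚ} (hε : ε ^ 2 = 1) (h : IsReciprocalRoots a b (α ^ 2) (β ^ 2)) :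
    octicResolvent (algebraMap ℚ L ε) α β ^ 2 = algebraMap ℚ L (b + 2 - 2 * ε * a) := by
  have hα : α ≠ 0 := ne_zero_pow two_ne_zero h.left_ne_zero
  have hβ : β ≠ 0 := ne_zero_pow two_ne_zero h.right_ne_zero
  have hε' : (algebraMap ℚ L ε) ^ 2 = 1 := by rw [← map_pow, hε, map_one]
  have ha : algebraMap ℚ L a = -(α ^ 2 + (α ^ 2)⁻¹ + (β ^ 2 + (β ^ 2)⁻¹)) := by
    rw [h.sum_eq, neg_neg]
  have hb : algebraMap ℚ L b = (α ^ 2 + (α ^ 2)⁻¹) * (β ^ 2 + (β ^ 2)⁻¹) + 2 := by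
    rw [h.prod_eq]; ring
  have hsq {y : L} (hy : y ≠ 0) :
      (y + algebraMap ℚ L ε / y) ^ 2 = y ^ 2 + (y ^ 2)⁻¹ + 2 * algebraMap ℚ L ε := by
    rw [add_sq, div_pow, hε', one_div]
    field_simp
    ring
  rw [octicResolvent, mul_pow, hsq hα, hsq hβ]
  simp only [map_add, map_sub, map_mul, map_ofNat, ha, hb]
  linear_combination 4 * hε'

/-- ρ swaps the two factors, as ε/α + ε/(ε/α) = α + ε/α. This needs the same ε in the resolvent and
in ρ β. -/
theorem map_octicResolvent_of_rotation (hε : ε ^ 2 = 1) {ρ : L ≃ₐ[ℚ] L} (hα : ρ α = β)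
    (hβ : ρ β = algebraMap ℚ L ε / α) :
    ρ (octicResolvent (algebraMap ℚ L ε) α β) = octicResolvent (algebraMap ℚ L ε) α β := by
  have hε₀ : algebraMap ℚ L ε ≠ 0 := by
    refine (_root_.map_ne_zero _).mpr ?_
    rintro rfl
    norm_num at hε
  simp only [octicResolvent, map_mul, map_add, map_div₀, AlgEquiv.commutes, hα, hβ,
    div_div_cancel₀ hε₀]
  ring

theorem range_permHom_eq_T8_2
    (hε : ε ^ 2 = 1)
    (hinj : Function.Injective (octicRoots (algebraMap ℚ L ε) α β))
    (hφ : ∀ σ i, octicRoots (algebraMap ℚ L ε) α β (φ σ i) =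
      σ (octicRoots (algebraMap ℚ L ε) α β i))
    (hfix : ∀ σ : L ≃ₐ[ℚ] L, σ (α ^ 2) = α ^ 2 → σ (β ^ 2) = β ^ 2)
    {ρ : L ≃ₐ[ℚ] L} (hα : ρ α = β) (hβ : ρ β = algebraMap ℚ L ε / α)
    (hneg : ∃ ν : L ≃ₐ[ℚ] L, ν α = -α)
    (hp₀ : octicResolvent (algebraMap ℚ L ε) α β ≠ 0)
    (hp : ∀ σ : L ≃ₐ[ℚ] L, σ (octicResolvent (algebraMap ℚ L ε) α β) =
      octicResolvent (algebraMap ℚ L ε) α β) :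
    φ.range = T8_2 := by
  have := algebraRat.charZero L
  -- Opposite signs on α and β would negate the fixed nonzero resolvent.
  obtain ⟨h₁, h₂⟩ : (∀ τ : L ≃ₐ[ℚ] L, τ α = α → τ β ≠ -β) ∧
      (∀ τ : L ≃ₐ[ℚ] L, τ α = -α → τ β ≠ β) := by
    constructor <;>
    · intro τ hτα hτβ
      have := hp τ
      simp only [octicResolvent, map_mul, map_add, map_div₀, AlgEquiv.commutes, hτα, hτβ,
        div_neg] at this
      refine hp₀ (self_eq_neg.mp ?_)
      rw [octicResolvent]
      linear_combination -this
  have hρ := permHom_eq_rotation hε hinj hφ hα hβ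
  refine le_antisymm ?_ ((Subgroup.closure_le _).mpr ?_)
  · rintro _ ⟨σ, rfl⟩
    obtain ⟨k, τ, rfl, hτα, hτβ⟩ :=
      exists_pow_mul_of_map_mem_range hε hfix hα hβ (σ := σ) ⟨φ σ 0, hφ σ 0⟩
    rw [map_mul, map_pow, hρ]
    refine mul_mem (pow_mem (Subgroup.subset_closure (Set.mem_insert _ _)) _) ?_
    obtain ⟨e₁, e₂, -, -⟩ := permHom_eq_of_map_eq_or_neg hinj hφ τ
    rcases hτα with hτα | hτα <;> rcases hτβ with hτβ | hτβ
    · rw [e₁ hτα hτβ]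
      exact one_mem _
    · exact absurd hτβ (h₁ τ hτα)
    · exact absurd hτβ (h₂ τ hτα)
    · rw [e₂ hτα hτβ]
      exact Subgroup.subset_closure (Set.mem_insert_of_mem _ rfl)
  · rintro _ (rfl | rfl)
    · exact ⟨ρ, hρ⟩
    · obtain ⟨ν, hν⟩ := hneg
      refine ⟨ν, (permHom_eq_of_map_eq_or_neg hinj hφ ν).2.1 hν ?_⟩
      have := hfix ν (by rw [map_pow, hν, neg_sq])
      rw [map_pow, sq_eq_sq_iff_eq_or_eq_neg] at this
      exact this.resolve_left (h₂ ν hν)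

theorem range_permHom_eq_T8_10
    (hε : ε ^ 2 = 1)
    (hinj : Function.Injective (octicRoots (algebraMap ℚ L ε) α β))
    (hφ : ∀ σ i, octicRoots (algebraMap ℚ L ε) α β (φ σ i) =
      σ (octicRoots (algebraMap ℚ L ε) α β i))
    (hfix : ∀ σ : L ≃ₐ[ℚ] L, σ (α ^ 2) = α ^ 2 → σ (β ^ 2) = β ^ 2)
    {ρ : L ≃ₐ[ℚ] L} (hα : ρ α = β) (hβ : ρ β = algebraMap ℚ L ε / α)
    (hp : ∃ σ : L ≃ₐ[ℚ] L, σ (octicResolvent (algebraMap ℚ L ε) α β) ≠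
      octicResolvent (algebraMap ℚ L ε) α β) :
    φ.range = T8_10 := by
  have hρ := permHom_eq_rotation hε hinj hφ hα hβ
  have hdecomp (σ : L ≃ₐ[ℚ] L) := exists_pow_mul_of_map_mem_range hε hfix hα hβ (σ := σ)
    ⟨φ σ 0, hφ σ 0⟩
  have hrot : c[0, 1, 2, 7] * c[3, 4, 5, 6] ∈ T8_10 :=
    Subgroup.subset_closure (Set.mem_insert _ _)
  have heven : c[0, 4] * c[2, 6] ∈ T8_10 :=
    Subgroup.subset_closure (Set.mem_insert_of_mem _ rfl)
  have hodd : c[1, 5] * c[3, 7] ∈ T8_10 := by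
    rw [oddNegation_eq_conj]
    exact mul_mem (mul_mem hrot heven) (inv_mem hrot)
  refine le_antisymm ?_ ((Subgroup.closure_le _).mpr ?_)
  · rintro _ ⟨σ, rfl⟩
    obtain ⟨k, τ, rfl, hτα, hτβ⟩ := hdecomp σ
    rw [map_mul, map_pow, hρ]
    refine mul_mem (pow_mem hrot _) ?_
    obtain ⟨e₁, e₂, e₃, e₄⟩ := permHom_eq_of_map_eq_or_neg hinj hφ τ
    rcases hτα with hτα | hτα <;> rcases hτβ with hτβ | hτβ
    · rw [e₁ hτα hτβ]
      exact one_mem _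
    · rw [e₄ hτα hτβ]
      exact hodd
    · rw [e₃ hτα hτβ]
      exact heven
    · rw [e₂ hτα hτβ, negation_eq_mul]
      exact mul_mem heven hodd
  · rintro _ (rfl | rfl)
    · exact ⟨ρ, hρ⟩
    · obtain ⟨σ, hσ⟩ := hp
      obtain ⟨k, τ, rfl, hτα, hτβ⟩ := hdecomp σ
      -- Powers of ρ fix the resolvent, so the sign change τ moves it and must have opposite signs
      -- on α and β.
      have hτ : τ (octicResolvent (algebraMap ℚ L ε) α β) ≠
          octicResolvent (algebraMap ℚ L ε) α β := by
        intro hτ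
        rw [AlgEquiv.mul_apply, hτ] at hσ
        refine hσ ?_
        clear hσ
        induction k with
        | zero => rw [pow_zero, AlgEquiv.one_apply]
        | succ k ih =>
          rw [pow_succ, AlgEquiv.mul_apply, map_octicResolvent_of_rotation hε hα hβ, ih]
      obtain ⟨-, -, e₃, e₄⟩ := permHom_eq_of_map_eq_or_neg hinj hφ τ
      rcases hτα with hτα | hτα <;> rcases hτβ with hτβ | hτβ
      · exact absurd (by simp [octicResolvent, hτα, hτβ]) hτ
      -- Conjugation by the rotation turns the odd negation into the even one.
      · refine ⟨ρ⁻¹ * τ * ρ, ?_⟩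
        rw [map_mul, map_mul, map_inv, hρ, e₄ hτα hτβ, oddNegation_eq_conj]
        group
      · exact ⟨τ, e₃ hτα hτβ⟩
      · exact absurd (by simp [octicResolvent, hτα, hτβ, div_neg]; ring) hτ

end ReciprocalOcticAction

/-! ### The two cases for the octic -/

section ReciprocalOcticGaloisGroup

variable {L : Type*} [Field L] [Algebra ℚ L] {a b : ℚ} {f : ℚ[X]}

/-- The numberings of the roots, and the permutation groups they give, in an arbitrary splitting
field. -/
theorem exists_numbering_reciprocalOctic [IsSplittingField ℚ L f]
    (hf : f = X ^ 8 + C a * X ^ 6 + C b * X ^ 4 + C a * X ^ 2 + 1)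
    (hg : Irreducible (X ^ 4 + C a * X ^ 3 + C b * X ^ 2 + C a * X + 1 : ℚ[X]))
    (hirr : Irreducible f) (hD : (b + 2) ^ 2 - 4 * a ^ 2 ≠ 0)
    (hsq : IsSquare ((a ^ 2 - 4 * b + 8) * ((b + 2) ^ 2 - 4 * a ^ 2))) :
    ((IsSquare (b + 2 - 2 * a) ∨ IsSquare (b + 2 + 2 * a)) →
      ∃ x : Fin 8 → L, Function.Injective x ∧ Set.range x = f.rootSet L ∧
        ∃ φ : (L ≃ₐ[ℚ] L) →* Equiv.Perm (Fin 8), (∀ σ i, x (φ σ i) = σ (x i)) ∧ φ.range = T8_2) ∧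
    (¬ (IsSquare (b + 2 - 2 * a) ∨ IsSquare (b + 2 + 2 * a)) →
      ∃ x : Fin 8 → L, Function.Injective x ∧ Set.range x = f.rootSet L ∧
        ∃ φ : (L ≃ₐ[ℚ] L) →* Equiv.Perm (Fin 8),
          (∀ σ i, x (φ σ i) = σ (x i)) ∧ φ.range = T8_10) := by
  have : Normal ℚ L := Normal.of_isSplittingField f
  have : FiniteDimensional ℚ L := IsSplittingField.finiteDimensional L f
  have : IsGalois ℚ L := ⟨⟩
  obtain ⟨α, β, h⟩ := exists_sq_isReciprocalRoots (L := L) hf hg hirr hD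
    (IsSplittingField.splits L f)
  have hfix (σ : L ≃ₐ[ℚ] L) := h.map_right_of_map_left_eq_left σ hsq
  have hroot := aeval_reciprocalOctic hf h
  obtain ⟨ρ, hρα⟩ : ∃ ρ : L ≃ₐ[ℚ] L, ρ α = β :=
    exists_algEquiv_map_eq_of_irreducible hirr (by rw [hroot]; simp) (by rw [hroot]; simp)
  have hneg : ∃ ν : L ≃ₐ[ℚ] L, ν α = -α :=
    exists_algEquiv_map_eq_of_irreducible hirr (by rw [hroot]; simp) (by rw [hroot]; simp)
  have hρβ : ρ β = 1 / α ∨ ρ β = -(1 / α) := by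
    have := h.map_right_of_map_left_eq_right ρ hsq (by rw [map_pow, hρα])
    rwa [map_pow, ← inv_pow, sq_eq_sq_iff_eq_or_eq_neg, ← one_div] at this
  have hnumbering {ε : ℚ} (hε : ε ^ 2 = 1) :
      Function.Injective (octicRoots (algebraMap ℚ L ε) α β) ∧
      Set.range (octicRoots (algebraMap ℚ L ε) α β) = f.rootSet L ∧
      ∃ φ : (L ≃ₐ[ℚ] L) →* Equiv.Perm (Fin 8), ∀ σ i,
        octicRoots (algebraMap ℚ L ε) α β (φ σ i) = σ (octicRoots (algebraMap ℚ L ε) α β i) := by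
    have hinj := injective_octicRoots hε hf hirr h
    have hrange := range_octicRoots hε hf hirr.ne_zero h
    refine ⟨hinj, hrange, exists_permHom_of_mapsTo _ hinj fun σ i ↦ ?_⟩
    rw [hrange]
    exact rootSet_mapsTo (p := f) σ.toAlgHom (hrange ▸ Set.mem_range_self i)
  -- The two values for ε = ±1 multiply to (b + 2)² - 4a².
  have hp₀ {ε : ℚ} (hε : ε = 1 ∨ ε = -1) : b + 2 - 2 * ε * a ≠ 0 := by
    rintro h₀
    apply hD
    rcases hε with rfl | rfl
    · linear_combination (b + 2 + 2 * a) * h₀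
    · linear_combination (b + 2 - 2 * a) * h₀
  have hε_sq {ε : ℚ} (hε : ε = 1 ∨ ε = -1) : ε ^ 2 = 1 := sq_eq_one_iff.mpr hε
  have hρε : ∃ ε : ℚ, (ε = 1 ∨ ε = -1) ∧ ρ β = algebraMap ℚ L ε / α := by
    rcases hρβ with hρβ | hρβ
    · exact ⟨1, Or.inl rfl, by rw [hρβ, map_one]⟩
    · exact ⟨-1, Or.inr rfl, by rw [hρβ, map_neg, map_one, neg_div]⟩
  constructor
  · intro hsquare
    obtain ⟨ε, hε, hεsq⟩ : ∃ ε : ℚ, (ε = 1 ∨ ε = -1) ∧ IsSquare (b + 2 - 2 * ε * a) := by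
      rcases hsquare with hs | hs
      · exact ⟨1, Or.inl rfl, by simpa using hs⟩
      · exact ⟨-1, Or.inr rfl, by simpa using hs⟩
    have hε₂ := hε_sq hε
    have hpsq := octicResolvent_sq hε₂ h
    have hpne : octicResolvent (algebraMap ℚ L ε) α β ≠ 0 := by
      refine ne_zero_pow two_ne_zero (n := 2) ?_
      rw [hpsq]
      exact (_root_.map_ne_zero _).mpr (hp₀ hε)
    have hp (σ : L ≃ₐ[ℚ] L) : σ (octicResolvent (algebraMap ℚ L ε) α β) =
        octicResolvent (algebraMap ℚ L ε) α β := by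
      obtain ⟨m, hm⟩ := exists_eq_algebraMap_of_sq_eq_of_isSquare hpsq hεsq
      rw [hm, AlgEquiv.commutes]
    -- The sign for which b + 2 - 2εa is a square must be the sign of ρ: with ρ β = -ε/α, ρ would
    -- negate the resolvent, which is rational and nonzero.
    have hρβ' : ρ β = algebraMap ℚ L ε / α := by
      obtain ⟨δ, hδ, hρδ⟩ := hρε
      by_cases hδε : δ = ε
      · rw [hρδ, hδε]
      · have hδ' : δ = -ε := by
          rcases hδ with rfl | rfl <;> rcases hε with rfl | rfl <;> simp_all
        have hε₀ : algebraMap ℚ L ε ≠ 0 := by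
          refine (_root_.map_ne_zero _).mpr ?_
          rintro rfl
          norm_num at hε₂
        have := algebraRat.charZero L
        refine absurd (self_eq_neg.mp ?_) hpne
        have hρp := hp ρ
        rw [hδ', map_neg, neg_div] at hρδ
        simp only [octicResolvent, map_mul, map_add, map_div₀, AlgEquiv.commutes, hρα, hρδ,
          div_neg, div_div_cancel₀ hε₀] at hρp ⊢
        linear_combination -hρp
    obtain ⟨hinj, hrange, φ, hφ⟩ := hnumbering hε₂
    exact ⟨_, hinj, hrange, φ, hφ,
      range_permHom_eq_T8_2 hε₂ hinj hφ hfix hρα hρβ' hneg hpne hp⟩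
  · intro hnonsquare
    obtain ⟨ε, hε, hρβ'⟩ := hρε
    have hε₂ := hε_sq hε
    obtain ⟨hinj, hrange, φ, hφ⟩ := hnumbering hε₂
    refine ⟨_, hinj, hrange, φ, hφ, range_permHom_eq_T8_10 hε₂ hinj hφ hfix hρα hρβ' ?_⟩
    -- A resolvent fixed by every automorphism is rational, so its square b + 2 - 2εa would be a
    -- rational square; both signs are excluded.
    by_contra! hp
    obtain ⟨m, hm⟩ := (IsGalois.mem_range_algebraMap_iff_fixed _).mpr hp
    have hpsq := octicResolvent_sq hε₂ h
    rw [← hm, ← map_pow] at hpsq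
    have hm₂ : IsSquare (b + 2 - 2 * ε * a) :=
      ⟨m, by rw [← sq]; exact ((algebraMap ℚ L).injective hpsq).symm⟩
    apply hnonsquare
    rcases hε with rfl | rfl
    · exact Or.inl (by simpa using hm₂)
    · exact Or.inr (by simpa using hm₂)

end ReciprocalOcticGaloisGroup

/-! ### Conclusion over the complex roots -/

theorem galoisGroupIs_of_numbering {f : ℚ[X]} {n : ℕ} {H : Subgroup (Equiv.Perm (Fin n))}
    (h : ∃ x : Fin n → f.SplittingField, Function.Injective x ∧
      Set.range x = f.rootSet f.SplittingField ∧ ∃ φ : f.Gal →* Equiv.Perm (Fin n),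
        (∀ σ i, x (φ σ i) = σ (x i)) ∧ φ.range = H) : GaloisGroupIs f H := by
  have : Fact (f.map (algebraMap ℚ ℂ)).Splits := Polynomial.Gal.splits_ℚ_ℂ
  obtain ⟨x, hinj, hrange, φ, hφ, rfl⟩ := h
  exact exists_equiv_map_range_galActionHom_eq f x hinj hrange φ hφ

theorem theorem4p6 (a b : ℚ) (ha : a ≠ 0) (f g : ℚ[X])
    (hf : f = X ^ 8 + C a * X ^ 6 + C b * X ^ 4 + C a * X ^ 2 + 1)
    (hg : g = X ^ 4 + C a * X ^ 3 + C b * X ^ 2 + C a * X + 1)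
    (hirr : Irreducible f)
    (h₁ : ¬ IsSquare ((b + 2) ^ 2 - 4 * a ^ 2))
    (h₂ : IsSquare ((a ^ 2 - 4 * b + 8) * ((b + 2) ^ 2 - 4 * a ^ 2))) :
    (IsCyclic g.Gal ∧ Nat.card g.Gal = 4) ∧
    ((IsSquare (b + 2 - 2 * a) ∨ IsSquare (b + 2 + 2 * a)) → GaloisGroupIs f T8_2) ∧
    (¬ (IsSquare (b + 2 - 2 * a) ∨ IsSquare (b + 2 + 2 * a)) → GaloisGroupIs f T8_10) := by
  have hD : (b + 2) ^ 2 - 4 * a ^ 2 ≠ 0 := fun h ↦ h₁ (h ▸ IsSquare.zero)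
  have hexpand : expand ℚ 2 g = f := by
    rw [hf, hg]
    simp only [map_add, map_mul, map_pow, expand_X, expand_C, map_one, ← pow_mul]
  have hgirr : Irreducible g := of_irreducible_expand two_ne_zero (hexpand ▸ hirr)
  have : IsSplittingField ℚ f.SplittingField f := IsSplittingField.splittingField f
  have : IsSplittingField ℚ g.SplittingField g := IsSplittingField.splittingField g
  have hcases := exists_numbering_reciprocalOctic (L := f.SplittingField) hf (hg ▸ hgirr) hirr hD h₂
  exact ⟨isCyclic_algEquiv_of_isSplittingField (L := g.SplittingField) hg hgirr hD h₂,
    fun h ↦ galoisGroupIs_of_numbering (hcases.1 h),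
    fun h ↦ galoisGroupIs_of_numbering (hcases.2 h)⟩
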